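/- Let $l:\mathbb{R}\to\mathbb{R}$ be of class $C^5$ and let $z_*\in\mathbb{R}$ be a local minimum point of $l$ such that $l''(z_*)>0$ and the product-stability $$\alpha_l(z_*) := 3\,\bigl(l^{(3)}(z_*)\bigr)^2 - l^{(4)}(z_*)\,l''(z_*)$$ is positive. Then there exist $\eta_0,\sigma,\tau>0$ (depending only on $l$ and $z_*$) such that the following holds for every learning rate $0<\eta\le\eta_0$ and every initialization $(x_0,y_0)\in\mathbb{R}^2$ with $$|x_0y_0-z_*|\le\sigma,\qquad 2\le \eta\, l''(z_*)\,(x_0^2+y_0^2)\le 2+\tau .$$ The gradient descent iterates for the objective $L(x,y)=l(xy)$, $$x_{t+1}=x_t-\eta\,\frac{\partial L}{\partial x}(x_t,y_t),\qquad y_{t+1}=y_t-\eta\,\frac{\partial L}{\partial y}(x_t,y_t)\qquad(t\ge 0),$$ converge, as $t\to\infty$, to a point $(x_\infty,y_\infty)\in\mathbb{R}^2$ with $x_\infty y_\infty=z_*$. -/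

import Mathlib

open Filter Topology

noncomputable section

/-- The product-stability `3 (f⁽³⁾(z))² - f⁽⁴⁾(z) f''(z)` of `f` at `z`. -/
def productStability (f : ℝ → ℝ) (z : ℝ) : ℝ :=
  3 * (iteratedDeriv 3 f z) ^ 2 - iteratedDeriv 4 f z * iteratedDeriv 2 f z

/-- The objective `L(x, y) = l(xy)`. -/
def productLoss (l : ℝ → ℝ) (p : ℝ × ℝ) : ℝ := l (p.1 * p.2)

/-- One step of gradient descent with learning rate `η` on an objective `L` of two real variables:
`(x, y) ↦ (x - η ∂L/∂x, y - η ∂L/∂y)`. -/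
def gdStep (L : ℝ × ℝ → ℝ) (η : ℝ) (p : ℝ × ℝ) : ℝ × ℝ :=
  (p.1 - η * deriv (fun x => L (x, p.2)) p.1, p.2 - η * deriv (fun y => L (p.1, y)) p.2)

/-- The `t`-th gradient descent iterate started at `p₀`. -/
def gdIterate (L : ℝ × ℝ → ℝ) (η : ℝ) (p₀ : ℝ × ℝ) : ℕ → ℝ × ℝ
  | 0 => p₀
  | t + 1 => gdStep L η (gdIterate L η p₀ t)

end

/-! Put `a = l''(zs)`, `u = xy - zs` and `Λ = aη(x² + y²)`. A step multiplies `u` by about `1 - Λ`,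
so `Λ = 2` is the threshold of a flip bifurcation. There the coordinate `v = u(1 + κu)` removes the
quadratic term and turns the map into `v ↦ -v + K u³` up to higher order, where `K` is the
product-stability divided by `3a²`. As `K > 0`, the cubic term pulls `v` inwards and absorbs a
slight excess of `Λ` over 2 (`flip_normal_form_bounds`). Meanwhile `M = aη|x² - y²|`, which is
within `δ` of `Λ` for small `η`, is multiplied by `1 - η² l'(xy)²`, so it never increases. Together
these give an invariant region (`Trapped.step`) on which `M` is bounded below. Hence `M` converges,
its decrements vanish, and these control `u²`; so `u → 0`. Convergence of `xy` and `|x² - y²|` then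
yields convergence of the point itself. -/

/-! ### Taylor expansion of the gradient -/

theorem deriv_eq_cubic_of_contDiff {l : ℝ → ℝ} {zs : ℝ} (hl : ContDiff ℝ 4 l)
    (hmin : IsLocalMin l zs) {a : ℝ} (ha : a = iteratedDeriv 2 l zs) (ha0 : a ≠ 0) {ε : ℝ}
    (hε : 0 < ε) :
    ∃ r > 0, ∀ u : ℝ, |u| ≤ r → ∃ p : ℝ, deriv l (zs + u) = a * u * (1 + p) ∧
      |p - (iteratedDeriv 3 l zs / (2 * a)) * u - (iteratedDeriv 4 l zs / (3 * a)) / 2 * u ^ 2|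
        ≤ ε * u ^ 2 := by
  have hd : ContDiff ℝ 3 (deriv l) := by
    have : ContDiff ℝ (3 + 1) l := by convert hl using 1; norm_num
    exact (contDiff_succ_iff_deriv.1 this).2.2
  have ht := taylor_isLittleO_univ (x₀ := zs) (n := 3) hd
  have ha1 : 0 < |a| := abs_pos.2 ha0
  have h := ht.bound (mul_pos hε ha1)
  rw [Metric.eventually_nhds_iff] at h
  obtain ⟨r, hr, h⟩ := h
  have h0 : deriv l zs = 0 := hmin.deriv_eq_zero
  refine ⟨r / 2, by positivity, fun u hu => ?_⟩
  by_cases hu0 : u = 0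
  · exact ⟨0, by simp [hu0, h0], by simp [hu0]⟩
  have h' := h (y := zs + u) (by simp; linarith)
  rw [taylor_within_apply] at h'
  simp only [Finset.sum_range_succ, Finset.sum_range_zero, iteratedDerivWithin_univ,
    iteratedDeriv_zero, h0] at h'
  rw [← iteratedDeriv_succ', ← iteratedDeriv_succ', ← iteratedDeriv_succ'] at h'
  simp only [Nat.reduceAdd, ← ha, add_sub_cancel_left, smul_eq_mul, Real.norm_eq_abs] at h'
  norm_num [Nat.factorial] at h'
  refine ⟨deriv l (zs + u) / (a * u) - 1, by field_simp; simp, ?_⟩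
  have hau : 0 < |a * u| := abs_pos.2 (mul_ne_zero ha0 hu0)
  refine le_of_mul_le_mul_left ?_ hau
  rw [← abs_mul]
  have e : a * u * (deriv l (zs + u) / (a * u) - 1 - iteratedDeriv 3 l zs / (2 * a) * u -
      iteratedDeriv 4 l zs / (3 * a) / 2 * u ^ 2) = deriv l (zs + u) - (u * a +
      1 / 2 * u ^ 2 * iteratedDeriv 3 l zs + 1 / 6 * u ^ 3 * iteratedDeriv 4 l zs) := by
    field_simp
    ring
  rw [e]
  refine h'.trans_eq ?_
  rw [abs_mul, ← sq_abs u]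
  ring

theorem exists_pos_small_mul_le (c d : ℝ) (hd : 0 < d) :
    ∃ r > 0, r ≤ 1 ∧ r * c ≤ d := by
  have : 0 < |c| + 1 := by positivity
  refine ⟨min 1 (d / (|c| + 1)), by positivity, min_le_left _ _, ?_⟩
  have h1 : min 1 (d / (|c| + 1)) * (|c| + 1) ≤ d := by
    rw [← le_div_iff₀ this]; exact min_le_right _ _
  have h2 : 0 < min 1 (d / (|c| + 1)) := by positivity
  nlinarith [le_abs_self c]

/-! ### Normal form of the flip -/

/-- Here `θ = 2 - Λ`, `t = κu`, and `e` is the second-order term in `η`. The last bound compares `m`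
with its value at `θ = e = 0`. -/
theorem flip_multiplier_bounds {t p δ θ e m : ℝ} (ht : |t| ≤ 1 / 200) (hp : |p| ≤ 1 / 200)
    (hδ : δ ≤ 1 / 200) (hθ0 : -2 * δ ≤ θ) (hθ1 : θ ≤ 11 / 10) (he : |e| ≤ δ)
    (hm : m = -1 - 2 * p + θ * (1 + p) + e) :
    |m - (θ - 1)| ≤ 1 / 50 ∧ |m * (1 + t * m) - (θ - 1)| ≤ 1 / 25 ∧
      (-1 - 2 * p) * (1 + t * (-1 - 2 * p)) - 4 * δ ≤ m * (1 + t * m) := by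
  have hm1 : |m - (θ - 1)| ≤ 1 / 50 := by
    have : m - (θ - 1) = p * (θ - 2) + e := by rw [hm]; ring
    rw [this]
    have h2 : |θ - 2| ≤ 201 / 100 := by rw [abs_le]; constructor <;> linarith
    calc |p * (θ - 2) + e| ≤ |p| * |θ - 2| + |e| := by rw [← abs_mul]; exact abs_add_le _ _
      _ ≤ 1 / 200 * (201 / 100) + 1 / 200 := by gcongr; linarith
      _ ≤ 1 / 50 := by norm_num
  obtain ⟨hp1, hp2⟩ := abs_le.1 hp
  obtain ⟨he1, he2⟩ := abs_le.1 he
  obtain ⟨hm3, hm4⟩ := abs_le.1 hm1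
  have hm2 : |m| ≤ 11 / 10 := by rw [abs_le]; constructor <;> linarith
  have hm5 : m ^ 2 ≤ 2 := by rw [← sq_abs]; nlinarith [abs_nonneg m]
  refine ⟨hm1, ?_, ?_⟩
  · have : m * (1 + t * m) - (θ - 1) = (m - (θ - 1)) + t * m ^ 2 := by ring
    rw [this]
    calc |(m - (θ - 1)) + t * m ^ 2| ≤ |m - (θ - 1)| + |t * m ^ 2| := abs_add_le _ _
      _ = |m - (θ - 1)| + |t| * m ^ 2 := by rw [abs_mul, abs_of_nonneg (sq_nonneg m)]
      _ ≤ 1 / 50 + 1 / 200 * 2 := by gcongr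
      _ ≤ 1 / 25 := by norm_num
  -- `n` is the deviation from the critical multiplier and enters with a factor `F ≈ 1`. Since `n ≥
  -- -3.1δ` and `F ≤ 41/40`, the loss is below `4δ`.
  obtain ⟨n, hn⟩ : ∃ n, n = θ * (1 + p) + e := ⟨_, rfl⟩
  obtain ⟨F, hF⟩ : ∃ F, F = 1 + 2 * t * (-1 - 2 * p) + t * n := ⟨_, rfl⟩
  have hmn : m = (-1 - 2 * p) + n := by rw [hm, hn]; ring
  have hsplit : m * (1 + t * m) = (-1 - 2 * p) * (1 + t * (-1 - 2 * p)) + n * F := by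
    rw [hmn, hF]; ring
  have hF' : |F - 1| ≤ 1 / 40 := by
    have h1 : F - 1 = t * (m + (-1 - 2 * p)) := by rw [hF, hmn]; ring
    rw [h1, abs_mul]
    have h2 : |m + (-1 - 2 * p)| ≤ 4 := by
      have := abs_le.1 hm2
      rw [abs_le]; constructor <;> linarith
    calc |t| * |m + (-1 - 2 * p)| ≤ 1 / 200 * 4 := by gcongr
      _ ≤ 1 / 40 := by norm_num
  obtain ⟨hF1, hF2⟩ := abs_le.1 hF'
  have hδ0 : 0 ≤ δ := (abs_nonneg e).trans he
  have hn2 : -(31 / 10 * δ) ≤ n := by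
    have h1 : 0 ≤ (θ + 2 * δ) * (1 + p) := mul_nonneg (by linarith) (by linarith)
    have h2 : δ * p ≤ δ * (1 / 200) := by gcongr
    rw [hn]; linarith
  have h1 : 0 ≤ (n + 31 / 10 * δ) * F := mul_nonneg (by linarith) (by linarith)
  have h2 : δ * F ≤ δ * (41 / 40) := by gcongr; linarith
  rw [hsplit]
  linarith

theorem flip_normal_form_bounds (κ γ : ℝ) (hK : 0 < 4 * κ ^ 2 - γ) :
    ∃ r > 0, r ≤ 1 ∧ ∀ u p : ℝ, |u| ≤ r →
      |p - κ * u - γ / 2 * u ^ 2| ≤ (4 * κ ^ 2 - γ) / 16 * u ^ 2 →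
      |κ * u| ≤ 1 / 200 ∧ |p| ≤ 1 / 200 ∧ ∀ δ θ e m : ℝ, δ ≤ 1 / 200 → -2 * δ ≤ θ → θ ≤ 11 / 10 →
        |e| ≤ δ → m = -1 - 2 * p + θ * (1 + p) + e →
        |m - (θ - 1)| ≤ 1 / 50 ∧ |m * (1 + κ * u * m) - (θ - 1)| ≤ 1 / 25 ∧
        -(1 + κ * u) + (4 * κ ^ 2 - γ) / 2 * u ^ 2 - 4 * δ ≤ m * (1 + κ * u * m) := by
  set K := 4 * κ ^ 2 - γ with hKdef
  set B := 1 + |κ| + |γ| + K with hB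
  have hκ := abs_nonneg κ
  have hγ := abs_nonneg γ
  obtain ⟨r, hr, hr1, hrB⟩ := exists_pos_small_mul_le (B + 8 * |κ| * B ^ 2)
    (min (1 / 400) (K / 4)) (by positivity)
  have hB1 : 1 ≤ B := by rw [hB]; linarith
  have hrB1 : r * B ≤ 1 / 400 := by
    have := min_le_left (1 / 400) (K / 4)
    have : 0 ≤ r * (8 * |κ| * B ^ 2) := by positivity
    linarith
  have hrB2 : r * (8 * |κ| * B ^ 2) ≤ K / 4 := by
    have := min_le_right (1 / 400) (K / 4)
    have : 0 ≤ r * B := by positivity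
    linarith
  refine ⟨r, hr, hr1, fun u p hu hp => ?_⟩
  have hu0 := abs_nonneg u
  set t := κ * u with ht
  have htu : |t| ≤ |κ| * r := by rw [ht, abs_mul]; gcongr
  have ht1 : |t| ≤ 1 / 200 := by
    have : |κ| * r ≤ r * B := by rw [mul_comm]; gcongr; rw [hB]; linarith
    linarith
  obtain ⟨R, hR⟩ : ∃ R, R = p - κ * u - γ / 2 * u ^ 2 := ⟨_, rfl⟩
  have hpR : p = t + γ / 2 * u ^ 2 + R := by rw [hR]; ring
  rw [← hR] at hp
  have huu : u ^ 2 ≤ |u| := by rw [← sq_abs]; nlinarith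
  have hpB : |p| ≤ B * |u| := by
    rw [hpR]
    calc |t + γ / 2 * u ^ 2 + R| ≤ |t| + |γ / 2 * u ^ 2| + |R| := abs_add_three _ _ _
      _ ≤ |κ| * |u| + |γ| * |u| + K * |u| := by
        gcongr
        · rw [ht, abs_mul]
        · rw [abs_mul, abs_div, abs_of_nonneg (sq_nonneg u)]; norm_num
          have : |γ| * u ^ 2 ≤ |γ| * |u| := by gcongr
          have : 0 ≤ |γ| * u ^ 2 := by positivity
          linarith
        · have : K * u ^ 2 ≤ K * |u| := by gcongr
          have : 0 ≤ K * u ^ 2 := by positivity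
          linarith
      _ ≤ B * |u| := by rw [hB]; linarith
  have hp1 : |p| ≤ 1 / 200 := by
    have : B * |u| ≤ r * B := by rw [mul_comm]; gcongr
    linarith
  refine ⟨ht1, hp1, fun δ θ e m hδ hθ0 hθ1 he hm => ?_⟩
  obtain ⟨hm1, hm2, hm3⟩ := flip_multiplier_bounds ht1 hp1 hδ hθ0 hθ1 he hm
  refine ⟨hm1, hm2, le_trans ?_ hm3⟩
  -- The error terms cost at most `K/8 + K/4` of the coefficient `K`, so `K/2` survives.
  have hmain : (-1 - 2 * p) * (1 + t * (-1 - 2 * p)) = -(1 + t) + K * u ^ 2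
      - 2 * R + t * (2 * γ * u ^ 2 + 4 * R + 4 * p ^ 2) := by
    have : t ^ 2 = κ ^ 2 * u ^ 2 := by rw [ht]; ring
    linear_combination (-2 + 4 * t) * hpR + 4 * this
  have hu2 := sq_nonneg u
  have hE : |t * (2 * γ * u ^ 2 + 4 * R + 4 * p ^ 2)| ≤ K / 4 * u ^ 2 := by
    have hp2 : p ^ 2 ≤ B ^ 2 * u ^ 2 := by
      rw [← sq_abs p, ← sq_abs u, ← mul_pow]; gcongr
    have : |2 * γ * u ^ 2 + 4 * R + 4 * p ^ 2| ≤ 8 * B ^ 2 * u ^ 2 := by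
      have hBB : B ≤ B ^ 2 := le_self_pow₀ hB1 two_ne_zero
      calc |2 * γ * u ^ 2 + 4 * R + 4 * p ^ 2|
          ≤ |2 * γ * u ^ 2| + |4 * R| + |4 * p ^ 2| := abs_add_three _ _ _
        _ = 2 * |γ| * u ^ 2 + 4 * |R| + 4 * p ^ 2 := by
          rw [abs_mul, abs_mul, abs_mul, abs_mul, abs_of_nonneg hu2, abs_of_nonneg (sq_nonneg p)]
          norm_num
        _ ≤ 2 * |γ| * u ^ 2 + 4 * (K / 16 * u ^ 2) + 4 * (B ^ 2 * u ^ 2) := by gcongr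
        _ ≤ (2 * B + B + 4 * B ^ 2) * u ^ 2 := by
          have h3 : 2 * |γ| + 4 * (K / 16) ≤ 3 * B := by rw [hB]; linarith
          have := mul_le_mul_of_nonneg_right h3 hu2
          linarith
        _ ≤ 8 * B ^ 2 * u ^ 2 := by gcongr ?_ * _; linarith
    rw [abs_mul]
    calc |t| * _ ≤ (|κ| * r) * (8 * B ^ 2 * u ^ 2) := by gcongr
      _ = (r * (8 * |κ| * B ^ 2)) * u ^ 2 := by ring
      _ ≤ _ := by gcongr
  have hE' := (abs_le.1 hE).1
  have hR' := (abs_le.1 hp).2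
  have := mul_nonneg hK.le hu2
  rw [hmain]
  linarith

/-! ### Invariance of the trapping region -/

/-- The bounds on the normalized gradient `g = a u (1 + p)` and on the multipliers of the
flip normal form that make the trapping region invariant. -/
def FlipBounds (κ K u p : ℝ) : Prop :=
  |κ * u| ≤ 1 / 200 ∧ |p| ≤ 1 / 200 ∧ ∀ δ θ e m : ℝ, δ ≤ 1 / 200 → -2 * δ ≤ θ → θ ≤ 11 / 10 →
    |e| ≤ δ → m = -1 - 2 * p + θ * (1 + p) + e →
    |m - (θ - 1)| ≤ 1 / 50 ∧ |m * (1 + κ * u * m) - (θ - 1)| ≤ 1 / 25 ∧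
    -(1 + κ * u) + K / 2 * u ^ 2 - 4 * δ ≤ m * (1 + κ * u * m)

/-- The trapping region, in terms of `u = xy - z_*` and `M = a η |x² - y²|`; `k = a² η²`. -/
structure Trapped (κ r δ k u M : ℝ) : Prop where
  dist_le : |u| ≤ r
  normal_abs_le : |u * (1 + κ * u)| ≤ r / 2
  le_two_add : M ≤ 2 + δ
  le_sub : 9 / 10 ≤ M - 4 * k * u ^ 2

theorem sq_one_add_le {p : ℝ} (hp : |p| ≤ 1 / 200) : (1 + p) ^ 2 ≤ 3 / 2 := by
  have := abs_le.1 hp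
  nlinarith

/-- The bound on `v` persists by the cubic contraction. For the lower bound on `M`, the potential `M
- 4ku²` pays in advance for the future decay of `M` once `u` contracts geometrically. -/
theorem Trapped.step {κ K r δ k u M Λ p e m : ℝ} (h : Trapped κ r δ k u M) (hr1 : r ≤ 1)
    (hK : 0 < K) (hδ : δ ≤ 1 / 200) (hδK : δ ≤ K * r ^ 2 / 128) (hk0 : 0 ≤ k) (hk : 4 * k ≤ δ)
    (hp : FlipBounds κ K u p) (hΛ1 : M ≤ Λ) (hΛ2 : Λ ≤ M + δ) (he : |e| ≤ δ)
    (hm : m = 1 - Λ * (1 + p) + e) :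
    Trapped κ r δ k (m * u) (M * (1 - k * (u * (1 + p)) ^ 2)) := by
  obtain ⟨hu, hv, hM, hMk⟩ := h
  obtain ⟨hκu, hp1, hbd⟩ := hp
  have hu0 := abs_nonneg u
  have hr0 : 0 ≤ r := hu0.trans hu
  have hku : 0 ≤ k * u ^ 2 := by positivity
  have hM9 : 9 / 10 ≤ M := by linarith
  obtain ⟨hm1, hQ1, hQ2⟩ := hbd δ (2 - Λ) e m hδ (by linarith) (by linarith) he
    (by rw [hm]; ring)
  obtain ⟨hm2, hm3⟩ := abs_le.1 hm1
  obtain ⟨hQ3, hQ4⟩ := abs_le.1 hQ1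
  obtain ⟨ht1, ht2⟩ := abs_le.1 hκu
  have hmabs : |m| ≤ 11 / 10 := by rw [abs_le]; constructor <;> linarith
  have ht0 : 0 ≤ 1 + κ * u := by linarith
  rw [abs_mul, abs_of_nonneg ht0] at hv
  have huv : |u| * (199 / 200) ≤ r / 2 :=
    (mul_le_mul_of_nonneg_left (by linarith) hu0).trans hv
  have hmu : |m * u| ≤ r := by
    rw [abs_mul]
    calc |m| * |u| ≤ 11 / 10 * |u| := by gcongr
      _ ≤ r := by linarith
  have hu1 : u ^ 2 ≤ 1 := by rw [← sq_abs]; exact pow_le_one₀ hu0 (hu.trans hr1)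
  have hmu1 : (m * u) ^ 2 ≤ 1 := by
    rw [← sq_abs]; exact pow_le_one₀ (abs_nonneg _) (hmu.trans hr1)
  have hp2 := sq_one_add_le hp1
  have hg0 : 0 ≤ k * (u * (1 + p)) ^ 2 := by positivity
  have hg : k * (u * (1 + p)) ^ 2 ≤ 3 / 2 * (k * u ^ 2) := by
    have := mul_le_mul_of_nonneg_left hp2 hku
    linarith [mul_pow u (1 + p) 2, show k * (u * (1 + p)) ^ 2 = k * u ^ 2 * (1 + p) ^ 2 by ring]
  have hku1 : k * u ^ 2 ≤ k := by simpa using mul_le_mul_of_nonneg_left hu1 hk0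
  have hkmu1 : k * (m * u) ^ 2 ≤ k := by simpa using mul_le_mul_of_nonneg_left hmu1 hk0
  refine ⟨hmu, ?_, ?_, ?_⟩
  · obtain ⟨Q, hQ⟩ : ∃ Q, Q = m * (1 + κ * u * m) := ⟨_, rfl⟩
    have : m * u * (1 + κ * (m * u)) = u * Q := by rw [hQ]; ring
    rw [this, abs_mul]
    rw [← hQ] at hQ2 hQ3 hQ4
    -- For `|u| ≥ r/4` the gain `K u²/2 ≥ K r²/32` covers the loss `4δ`; for smaller `u`, doubling
    -- still stays within `r/2`.
    by_cases hcase : r / 4 ≤ |u|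
    · have hru : r ^ 2 / 16 ≤ u ^ 2 := by
        rw [← sq_abs u]
        calc r ^ 2 / 16 = (r / 4) ^ 2 := by ring
          _ ≤ |u| ^ 2 := by gcongr
      have := mul_le_mul_of_nonneg_left hru hK.le
      have hQabs : |Q| ≤ 1 + κ * u := by
        rw [abs_le]; constructor <;> linarith
      exact (mul_le_mul_of_nonneg_left hQabs hu0).trans hv
    · have hQabs : |Q| ≤ 2 := by
        rw [abs_le]; constructor <;> linarith
      have := mul_le_mul_of_nonneg_left hQabs hu0
      linarith
  · have := mul_nonneg (by linarith : 0 ≤ M) hg0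
    linarith
  · have hMg : M * (k * (u * (1 + p)) ^ 2) ≤ M * (3 / 2 * (k * u ^ 2)) :=
      mul_le_mul_of_nonneg_left hg (by linarith)
    -- From `M ≥ 1` one step cannot reach `9/10`, `k` being tiny. For `M < 1`, `|m| ≤ 1/2`, and the
    -- drop `3/2 ku²` of `M` is less than the `3ku²` released by the potential.
    by_cases hM1 : 1 ≤ M
    · have : M * (k * (u * (1 + p)) ^ 2) ≤ 3 * (3 / 2 * (k * u ^ 2)) :=
        mul_le_mul (by linarith) hg hg0 (by norm_num)
      linarith
    · have h1 : M * (3 / 2 * (k * u ^ 2)) ≤ 3 / 2 * (k * u ^ 2) :=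
        mul_le_of_le_one_left (by positivity) (by linarith)
      have h2 : |m| ≤ 1 / 2 := by rw [abs_le]; constructor <;> linarith
      have h3 : m ^ 2 ≤ 1 / 4 := by
        rw [← sq_abs]
        calc |m| ^ 2 ≤ (1 / 2) ^ 2 := by gcongr
          _ = 1 / 4 := by norm_num
      have h4 := mul_le_mul_of_nonneg_right h3 hku
      have h5 : k * (m * u) ^ 2 = m ^ 2 * (k * u ^ 2) := by ring
      linarith

/-! ### Convergence -/

theorem tendsto_zero_of_trapped {κ r δ k : ℝ} {u M p : ℕ → ℝ} (hk : 0 < k)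
    (h : ∀ t, Trapped κ r δ k (u t) (M t)) (hp : ∀ t, |p t| ≤ 1 / 200)
    (hM : ∀ t, M (t + 1) = M t * (1 - k * (u t * (1 + p t)) ^ 2)) :
    Tendsto u atTop (𝓝 0) ∧ ∃ Minf, Tendsto M atTop (𝓝 Minf) := by
  have hM9 : ∀ t, 9 / 10 ≤ M t := fun t => by
    have := (h t).le_sub
    have : 0 ≤ 4 * k * u t ^ 2 := by positivity
    linarith
  have hanti : Antitone M := antitone_nat_of_succ_le fun t => by
    have := hM9 t
    have : 0 ≤ M t * (k * (u t * (1 + p t)) ^ 2) := by positivity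
    rw [hM]; linarith
  have hlim := tendsto_atTop_ciInf hanti ⟨9 / 10, by rintro _ ⟨t, rfl⟩; exact hM9 t⟩
  refine ⟨?_, _, hlim⟩
  -- The decrement is `k M (1 + p)² u²` with `M (1 + p)² ≥ 27/40 > 1/2`, so the factor `2/k` makes
  -- it dominate `u²`.
  have hdiff : Tendsto (fun t => (M t - M (t + 1)) * (2 / k)) atTop (𝓝 0) := by
    simpa using (hlim.sub ((tendsto_add_atTop_iff_nat 1).2 hlim)).mul_const (2 / k)
  have hsq : Tendsto (fun t => u t ^ 2) atTop (𝓝 0) := by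
    refine squeeze_zero (fun t => sq_nonneg _) (fun t => ?_) hdiff
    have h1 : (3 / 4 : ℝ) ≤ (1 + p t) ^ 2 := by
      have := abs_le.1 (hp t)
      nlinarith
    have h2 : 9 / 10 * (3 / 4) ≤ M t * (1 + p t) ^ 2 :=
      mul_le_mul (hM9 t) h1 (by norm_num) (by linarith [hM9 t])
    have h3 := mul_le_mul_of_nonneg_right h2 (sq_nonneg (u t))
    have h4 : (M t - M (t + 1)) * (2 / k) = 2 * (M t * (1 + p t) ^ 2 * u t ^ 2) := by
      rw [hM]; field_simp; ring
    rw [h4]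
    linarith [sq_nonneg (u t)]
  have := hsq.sqrt
  simp only [Real.sqrt_sq_eq_abs, Real.sqrt_zero] at this
  exact (tendsto_zero_iff_abs_tendsto_zero _).2 this

/-- Positive factors preserve the sign of `P`, so the limit of `|P|` fixes that of `P`. -/
theorem exists_tendsto_of_sq_of_mul_pos {P c : ℕ → ℝ} {A : ℝ} (hc : ∀ t, 0 < c t)
    (hP : ∀ t, P (t + 1) = c t * P t) (h : Tendsto (fun t => P t ^ 2) atTop (𝓝 A)) :
    ∃ B, Tendsto P atTop (𝓝 B) := by
  have habs : Tendsto (fun t => |P t|) atTop (𝓝 (√A)) := by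
    simpa only [Real.sqrt_sq_eq_abs] using h.sqrt
  rcases le_total 0 (P 0) with h0 | h0
  · have hn : ∀ t, 0 ≤ P t := fun t => by
      induction t with
      | zero => exact h0
      | succ t ih => rw [hP]; exact mul_nonneg (hc t).le ih
    exact ⟨_, habs.congr fun t => abs_of_nonneg (hn t)⟩
  · have hn : ∀ t, P t ≤ 0 := fun t => by
      induction t with
      | zero => exact h0
      | succ t ih => rw [hP]; exact mul_nonpos_of_nonneg_of_nonpos (hc t).le ih
    exact ⟨_, habs.neg.congr fun t => by rw [abs_of_nonpos (hn t), neg_neg]⟩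

theorem gdStep_productLoss {l : ℝ → ℝ} (hl : Differentiable ℝ l) (η : ℝ) (q : ℝ × ℝ) :
    gdStep (productLoss l) η q = (q.1 - η * (deriv l (q.1 * q.2) * q.2),
      q.2 - η * (deriv l (q.1 * q.2) * q.1)) := by
  have h1 : HasDerivAt (fun x => productLoss l (x, q.2)) (deriv l (q.1 * q.2) * q.2) q.1 := by
    have := (hl (q.1 * q.2)).hasDerivAt.comp q.1 ((hasDerivAt_id q.1).mul_const q.2)
    simpa [productLoss, Function.comp_def] using this
  have h2 : HasDerivAt (fun y => productLoss l (q.1, y)) (deriv l (q.1 * q.2) * q.1) q.2 := by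
    have := (hl (q.1 * q.2)).hasDerivAt.comp q.2 ((hasDerivAt_id q.2).const_mul q.1)
    simpa [productLoss, Function.comp_def] using this
  simp only [gdStep, h1.deriv, h2.deriv]

theorem sq_add_sq_bounds (x y : ℝ) :
    |x ^ 2 - y ^ 2| ≤ x ^ 2 + y ^ 2 ∧ x ^ 2 + y ^ 2 ≤ |x ^ 2 - y ^ 2| + 2 * |x * y| ∧
      x ^ 2 + y ^ 2 = √(|x ^ 2 - y ^ 2| ^ 2 + 4 * (x * y) ^ 2) := by
  have h : x ^ 2 + y ^ 2 = √(|x ^ 2 - y ^ 2| ^ 2 + 4 * (x * y) ^ 2) := by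
    rw [sq_abs, show (x ^ 2 - y ^ 2) ^ 2 + 4 * (x * y) ^ 2 = (x ^ 2 + y ^ 2) ^ 2 by ring,
      Real.sqrt_sq (by positivity)]
  refine ⟨?_, ?_, h⟩
  · rw [abs_le]; constructor <;> linarith [sq_nonneg x, sq_nonneg y]
  · rw [h]
    refine Real.sqrt_le_iff.2 ⟨by positivity, ?_⟩
    rw [← sq_abs (x * y)]
    have := mul_nonneg (abs_nonneg (x ^ 2 - y ^ 2)) (abs_nonneg (x * y))
    linarith

/-- The step is diagonal in `x ± y`, with positive factors `1 ∓ c`, and `(x ± y)² = x² + y² ± 2xy`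
converges. -/
theorem exists_tendsto_of_mul_of_abs_sq_sub {q : ℕ → ℝ × ℝ} {c : ℕ → ℝ} {zs A : ℝ}
    (hc : ∀ t, |c t| < 1)
    (hq : ∀ t, q (t + 1) = ((q t).1 - c t * (q t).2, (q t).2 - c t * (q t).1))
    (hz : Tendsto (fun t => (q t).1 * (q t).2) atTop (𝓝 zs))
    (hD : Tendsto (fun t => |(q t).1 ^ 2 - (q t).2 ^ 2|) atTop (𝓝 A)) :
    ∃ p : ℝ × ℝ, p.1 * p.2 = zs ∧ Tendsto q atTop (𝓝 p) := by
  have hs : Tendsto (fun t => (q t).1 ^ 2 + (q t).2 ^ 2) atTop (𝓝 √(A ^ 2 + 4 * zs ^ 2)) := by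
    refine ((hD.pow 2).add ((hz.pow 2).const_mul 4)).sqrt.congr fun t => ?_
    exact (sq_add_sq_bounds _ _).2.2.symm
  obtain ⟨B, hB⟩ := exists_tendsto_of_sq_of_mul_pos (P := fun t => (q t).1 + (q t).2)
    (c := fun t => 1 - c t) (fun t => by linarith [(abs_lt.1 (hc t)).2])
    (fun t => by rw [hq]; ring) ((hs.add (hz.const_mul 2)).congr fun t => by ring)
  obtain ⟨C, hC⟩ := exists_tendsto_of_sq_of_mul_pos (P := fun t => (q t).1 - (q t).2)
    (c := fun t => 1 + c t) (fun t => by linarith [(abs_lt.1 (hc t)).1])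
    (fun t => by rw [hq]; ring) ((hs.sub (hz.const_mul 2)).congr fun t => by ring)
  have hx : Tendsto (fun t => (q t).1) atTop (𝓝 ((B + C) / 2)) :=
    ((hB.add hC).div_const 2).congr fun t => by ring
  have hy : Tendsto (fun t => (q t).2) atTop (𝓝 ((B - C) / 2)) :=
    ((hB.sub hC).div_const 2).congr fun t => by ring
  exact ⟨(_, _), tendsto_nhds_unique (hx.mul hy) hz, hx.prodMk_nhds hy⟩

/-! ### Choice of constants and conclusion -/

theorem mainTheorem1 (l : ℝ → ℝ) (zs : ℝ) (hl : ContDiff ℝ 5 l) (hmin : IsLocalMin l zs)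
    (hl2 : 0 < iteratedDeriv 2 l zs) (hα : 0 < productStability l zs) :
    ∃ η₀ > (0 : ℝ), ∃ σ > (0 : ℝ), ∃ τ > (0 : ℝ),
      ∀ η : ℝ, 0 < η → η ≤ η₀ →
      ∀ x₀ y₀ : ℝ, |x₀ * y₀ - zs| ≤ σ →
        2 ≤ η * iteratedDeriv 2 l zs * (x₀ ^ 2 + y₀ ^ 2) →
        η * iteratedDeriv 2 l zs * (x₀ ^ 2 + y₀ ^ 2) ≤ 2 + τ →
        ∃ p : ℝ × ℝ, p.1 * p.2 = zs ∧
          Tendsto (gdIterate (productLoss l) η (x₀, y₀)) atTop (𝓝 p) := by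
  obtain ⟨a, ha⟩ : ∃ a, a = iteratedDeriv 2 l zs := ⟨_, rfl⟩
  rw [← ha] at hl2 ⊢
  obtain ⟨κ, hκ⟩ : ∃ κ, κ = iteratedDeriv 3 l zs / (2 * a) := ⟨_, rfl⟩
  obtain ⟨γ, hγ⟩ : ∃ γ, γ = iteratedDeriv 4 l zs / (3 * a) := ⟨_, rfl⟩
  obtain ⟨K, hKdef⟩ : ∃ K, K = 4 * κ ^ 2 - γ := ⟨_, rfl⟩
  have hK : 0 < K := by
    have : K = productStability l zs / (3 * a ^ 2) := by
      rw [hKdef, hκ, hγ, productStability, ← ha]; field_simp; ring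
    rw [this]; positivity
  obtain ⟨r₁, hr₁, hr₁1, hflip⟩ := flip_normal_form_bounds κ γ (hKdef ▸ hK)
  obtain ⟨r₂, hr₂, htaylor⟩ := deriv_eq_cubic_of_contDiff (hl.of_le (by norm_num)) hmin ha
    hl2.ne' (show 0 < K / 16 by positivity)
  rw [← hκ, ← hγ] at htaylor
  rw [← hKdef] at hflip
  obtain ⟨r, hr⟩ : ∃ r, r = min r₁ r₂ := ⟨_, rfl⟩
  have hr0 : 0 < r := by rw [hr]; positivity
  have hr1 : r ≤ 1 := by rw [hr]; exact (min_le_left _ _).trans hr₁1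
  have hgrad : ∀ u, |u| ≤ r → ∃ p, deriv l (zs + u) = a * u * (1 + p) ∧ FlipBounds κ K u p := by
    intro u hu
    rw [hr] at hu
    obtain ⟨p, hp1, hp2⟩ := htaylor u (hu.trans (min_le_right _ _))
    exact ⟨p, hp1, hflip u p (hu.trans (min_le_left _ _)) hp2⟩
  obtain ⟨δ, hδdef⟩ : ∃ δ, δ = min (1 / 200) (K * r ^ 2 / 128) := ⟨_, rfl⟩
  have hδ0 : 0 < δ := by rw [hδdef]; positivity
  have hδ : δ ≤ 1 / 200 := by rw [hδdef]; exact min_le_left _ _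
  have hδK : δ ≤ K * r ^ 2 / 128 := by rw [hδdef]; exact min_le_right _ _
  obtain ⟨Z, hZ⟩ : ∃ Z, Z = |zs| + 1 := ⟨_, rfl⟩
  have hZ1 : 1 ≤ Z := by rw [hZ]; linarith [abs_nonneg zs]
  -- `Z` bounds `|xy|` on the region. The first summand gives `Λ ≤ M + δ`; the second bounds the
  -- term quadratic in `η`.
  obtain ⟨η₀, hη₀, hη₀1, hη₀δ⟩ := exists_pos_small_mul_le (2 * a * Z + 4 * a ^ 2 * Z) δ hδ0
  refine ⟨η₀, hη₀, r / 4, by positivity, δ, hδ0, fun η hη hηη₀ x₀ y₀ hinit hlo hhi => ?_⟩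
  have hηδ : η * (2 * a * Z + 4 * a ^ 2 * Z) ≤ δ :=
    (mul_le_mul_of_nonneg_right hηη₀ (by positivity)).trans hη₀δ
  have h2aZ : η * (2 * a * Z) ≤ δ := by
    have : 0 ≤ η * (4 * a ^ 2 * Z) := by positivity
    linarith
  obtain ⟨k, hk⟩ : ∃ k, k = a ^ 2 * η ^ 2 := ⟨_, rfl⟩
  have hk0 : 0 < k := by rw [hk]; positivity
  have hkZ : 4 * k * Z ≤ δ := by
    have h1 : η ^ 2 ≤ η := by
      rw [sq]; exact mul_le_of_le_one_left hη.le (hηη₀.trans hη₀1)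
    calc 4 * k * Z = η ^ 2 * (4 * a ^ 2 * Z) := by rw [hk]; ring
      _ ≤ η * (4 * a ^ 2 * Z) := by gcongr
      _ ≤ δ := by
        have : 0 ≤ η * (2 * a * Z) := by positivity
        linarith
  have hk4 : 4 * k ≤ δ := (le_mul_of_one_le_right (by positivity) hZ1).trans hkZ
  obtain ⟨q, hq⟩ : ∃ q, q = gdIterate (productLoss l) η (x₀, y₀) := ⟨_, rfl⟩
  rw [← hq]
  obtain ⟨u, hu⟩ : ∃ u : ℕ → ℝ, ∀ t, u t = (q t).1 * (q t).2 - zs := ⟨_, fun _ => rfl⟩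
  obtain ⟨M, hM⟩ : ∃ M : ℕ → ℝ, ∀ t, M t = a * η * |(q t).1 ^ 2 - (q t).2 ^ 2| :=
    ⟨_, fun _ => rfl⟩
  have hstep : ∀ t, q (t + 1) = ((q t).1 - η * deriv l (zs + u t) * (q t).2,
      (q t).2 - η * deriv l (zs + u t) * (q t).1) := fun t => by
    have h0 : q (t + 1) = gdStep (productLoss l) η (q t) := by rw [hq]; rfl
    rw [h0, gdStep_productLoss (hl.differentiable (by norm_num)), hu, add_sub_cancel]
    simp only [mul_assoc]
  have hz : ∀ t, |u t| ≤ r → |(q t).1 * (q t).2| ≤ Z := fun t ht => by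
    have : (q t).1 * (q t).2 = zs + u t := by rw [hu]; ring
    rw [this, hZ]
    exact (abs_add_le _ _).trans (by linarith)
  have hΛ : ∀ t, |u t| ≤ r → M t ≤ a * η * ((q t).1 ^ 2 + (q t).2 ^ 2) ∧
      a * η * ((q t).1 ^ 2 + (q t).2 ^ 2) ≤ M t + δ := fun t ht => by
    obtain ⟨h1, h2, -⟩ := sq_add_sq_bounds (q t).1 (q t).2
    have haη : 0 < a * η := mul_pos hl2 hη
    rw [hM]
    refine ⟨mul_le_mul_of_nonneg_left h1 haη.le, ?_⟩
    have h3 : (q t).1 ^ 2 + (q t).2 ^ 2 ≤ |(q t).1 ^ 2 - (q t).2 ^ 2| + 2 * Z := by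
      linarith [hz t ht]
    have := mul_le_mul_of_nonneg_left h3 haη.le
    linarith
  have hcsq : ∀ v p, |v| ≤ r → |p| ≤ 1 / 200 → k * (v * (1 + p)) ^ 2 ≤ 3 / 2 * k := by
    intro v p hv hp
    have h1 : v ^ 2 ≤ 1 := by
      rw [← sq_abs]; exact pow_le_one₀ (abs_nonneg _) (hv.trans hr1)
    have h2 : v ^ 2 * (1 + p) ^ 2 ≤ 1 * (3 / 2) :=
      mul_le_mul h1 (sq_one_add_le hp) (sq_nonneg _) zero_le_one
    have := mul_le_mul_of_nonneg_left h2 hk0.le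
    rw [mul_pow]; linarith
  have hnext : ∀ t p, |u t| ≤ r → |p| ≤ 1 / 200 → deriv l (zs + u t) = a * u t * (1 + p) →
      M (t + 1) = M t * (1 - k * (u t * (1 + p)) ^ 2) := by
    intro t p hut hp hg
    have hc := hcsq _ _ hut hp
    rw [hM, hM, hstep, hg]
    have h1 : ((q t).1 - η * (a * u t * (1 + p)) * (q t).2) ^ 2 -
        ((q t).2 - η * (a * u t * (1 + p)) * (q t).1) ^ 2 =
        ((q t).1 ^ 2 - (q t).2 ^ 2) * (1 - k * (u t * (1 + p)) ^ 2) := by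
      rw [hk]; ring
    simp only [h1, abs_mul]
    rw [abs_of_nonneg (show 0 ≤ 1 - k * (u t * (1 + p)) ^ 2 by linarith)]
    ring
  have htrap : ∀ t, Trapped κ r δ k (u t) (M t) := by
    intro t
    induction t with
    | zero =>
      have hq0 : q 0 = (x₀, y₀) := by rw [hq]; rfl
      have hu0 : |u 0| ≤ r / 4 := by rw [hu, hq0]; exact hinit
      have hu0r : |u 0| ≤ r := by linarith
      obtain ⟨p, -, hp, -⟩ := hgrad (u 0) hu0r
      obtain ⟨h1, h2⟩ := hΛ 0 hu0r
      have h3 : a * η * ((q 0).1 ^ 2 + (q 0).2 ^ 2) = η * a * (x₀ ^ 2 + y₀ ^ 2) := by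
        rw [hq0]; ring
      rw [h3] at h1 h2
      have h4 : u 0 ^ 2 ≤ 1 := by
        rw [← sq_abs]; exact pow_le_one₀ (abs_nonneg _) (hu0r.trans hr1)
      have h5 := mul_le_mul_of_nonneg_left h4 hk0.le
      refine ⟨hu0r, ?_, by linarith, by linarith⟩
      rw [abs_mul]
      have h6 : |1 + κ * u 0| ≤ 2 := by
        have := abs_le.1 hp
        rw [abs_le]; constructor <;> linarith
      calc |u 0| * |1 + κ * u 0| ≤ r / 4 * 2 := by gcongr
        _ = r / 2 := by ring
    | succ t ih =>
      have hut := ih.dist_le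
      obtain ⟨p, hg, hp⟩ := hgrad (u t) hut
      obtain ⟨hΛ1, hΛ2⟩ := hΛ t hut
      have he : |k * (1 + p) ^ 2 * u t * ((q t).1 * (q t).2)| ≤ δ := by
        rw [abs_mul, abs_mul, abs_of_nonneg (show 0 ≤ k * (1 + p) ^ 2 by positivity)]
        calc k * (1 + p) ^ 2 * |u t| * |(q t).1 * (q t).2|
            ≤ k * (3 / 2) * 1 * Z := by
              gcongr
              · exact sq_one_add_le hp.2.1
              · exact hut.trans hr1
              · exact hz t hut
          _ ≤ 4 * k * Z := by
            have := mul_nonneg hk0.le (zero_le_one.trans hZ1)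
            linarith
          _ ≤ δ := hkZ
      have hmain := ih.step hr1 hK hδ hδK hk0.le hk4 hp hΛ1 hΛ2 he rfl
      rw [← hnext t p hut hp.2.1 hg] at hmain
      convert hmain using 1
      rw [hu (t + 1), hstep, hg, hk]
      have hzu : zs = (q t).1 * (q t).2 - u t := by rw [hu]; ring
      rw [hzu]
      ring
  choose p hpg hpF using fun t => hgrad (u t) (htrap t).dist_le
  have hp200 : ∀ t, |p t| ≤ 1 / 200 := fun t => (hpF t).2.1
  obtain ⟨hu0, Minf, hMinf⟩ := tendsto_zero_of_trapped hk0 htrap hp200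
    fun t => hnext t (p t) (htrap t).dist_le (hp200 t) (hpg t)
  refine exists_tendsto_of_mul_of_abs_sq_sub (c := fun t => η * deriv l (zs + u t))
    (A := Minf / (a * η)) (fun t => ?_) hstep ?_ ?_
  · have h1 := hcsq _ _ (htrap t).dist_le (hp200 t)
    rw [← sq_lt_one_iff_abs_lt_one, hpg]
    have : (η * (a * u t * (1 + p t))) ^ 2 = k * (u t * (1 + p t)) ^ 2 := by rw [hk]; ring
    linarith
  · have := hu0.const_add zs
    rw [add_zero] at this
    exact this.congr fun t => by rw [hu]; ring
  · refine (hMinf.div_const (a * η)).congr fun t => ?_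
    rw [hM]; field_simp
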